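/- Let $ABC$ be a non-degenerate triangle in the Euclidean plane, and let $\Gamma$ be a circle with centre $O$ that meets each of the lines $BC, CA, AB$ in two distinct points, $\{A_1,A_2\}$, $\{B_1,B_2\}$, $\{C_1,C_2\}$ respectively. Let $P$ be the Miquel point of $A_1B_1C_1$ in $ABC$, that is, the common point of the circles $(AB_1C_1)$, $(BC_1A_1)$, $(CA_1B_1)$, and let $Q$ be the Miquel point of $A_2B_2C_2$ in $ABC$. (If one of the points on a sideline coincides with a vertex, the circle through that vertex is understood to be tangent to that sideline at the vertex.) Put $$T_A = PA_1\cap QA_2,\qquad T_B = PB_1\cap QB_2,\qquad T_C = PC_1\cap QC_2 .$$ Let $A'$ be the second point of intersection of the circles $(AB_1C_1)$ and $(AB_2C_2)$, and let $B'$ be the second point of intersection of $(BC_1A_1)$ and $(BC_2A_2)$; define $C'$ in the same way. (If the two circles through $A$ are tangent there, then $A'=A$ and $AA'$ denotes their common tangent; likewise for $B$ and $C$.) Let $R$ be the point of intersection of the lines $AA'$ and $BB'$; it is known that $R$ also lies on $CC'$. Let $S_t$ (the generalized Steiner point) be the point of intersection of the parallel through $A$ to $T_BT_C$ and the parallel through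 $B$ to $T_CT_A$. Assume that each of the pairs $(P,A_1),(P,B_1),(P,C_1),(Q,A_2),(Q,B_2),(Q,C_2),(T_B,T_C),(T_C,T_A)$ consists of two distinct points, and that $T_A,T_B,T_C,R$ exist as points of the plane (no two of the lines used to define one of them are parallel). Then $S_t$ lies on the circumcircle of $ABC$, $O\ne R$, and the Simson line of $S_t$ with respect to $ABC$ (the line through the feet of the perpendiculars from $S_t$ to $BC$, $CA$, $AB$) is parallel to the line $OR$ (possibly equal to it). -/

import Mathlib

open EuclideanGeometry Affine

/-- The Euclidean plane. -/
abbrev Plane := EuclideanSpace ℝ (Fin 2)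

/-- The circle `Γ` meets the line `UV` exactly in the two distinct points `X`, `Y`. -/
def CutsLineAt (Γ : Sphere Plane) (U V X Y : Plane) : Prop :=
  X ≠ Y ∧ (Γ : Set Plane) ∩ line[ℝ, U, V] = {X, Y}

/-- `V` lies on the circle `s`, and the line `ℓ` through `V` meets `s` again at `X`; as usual the
second point of intersection is `V` itself exactly when `ℓ` is tangent to `s` at `V`. -/
structure MeetsAgainAt (s : Sphere Plane) (V X : Plane) (ℓ : AffineSubspace ℝ Plane) : Prop where
  vertex_mem : V ∈ s
  point_mem : X ∈ s
  vertex_mem_line : V ∈ ℓ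
  point_mem_line : X ∈ ℓ
  tangent : X = V → s.IsTangentAt V ℓ

/-- `s` is the circle `VXY`, where `X` is on the line `VU` and `Y` is on the line `VW`. If `X` (or
`Y`) coincides with `V`, this is the circle through the remaining points that is tangent at `V` to
the line `VU` (or `VW`). -/
def IsCornerCircle (s : Sphere Plane) (V U W X Y : Plane) : Prop :=
  MeetsAgainAt s V X line[ℝ, V, U] ∧ MeetsAgainAt s V Y line[ℝ, V, W]

/-- `M` is the Miquel point of `D`, `E`, `F` (on the lines `BC`, `CA`, `AB`) in the triangle `ABC`:
the common point of the circles `kA = AEF`, `kB = BFD`, `kC = CDE`. -/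
structure IsMiquelPoint (A B C D E F : Plane) (kA kB kC : Sphere Plane) (M : Plane) : Prop where
  circleA : IsCornerCircle kA A C B E F
  circleB : IsCornerCircle kB B A C F D
  circleC : IsCornerCircle kC C B A D E
  memA : M ∈ kA
  memB : M ∈ kB
  memC : M ∈ kC

/-- `T` is the point of intersection of the lines `XY` and `ZW`. -/
def IsLineIntersection (X Y Z W T : Plane) : Prop :=
  X ≠ Y ∧ Z ≠ W ∧ (line[ℝ, X, Y] : Set Plane) ∩ line[ℝ, Z, W] = {T}

/-- The distinct circles `s`, `s'` through `V` meet again at `V'`, and `ℓ` is the line `VV'`.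
If the circles are tangent at `V`, then `V' = V` and `ℓ` is their common tangent at `V`. -/
structure IsCommonChord (s s' : Sphere Plane) (V V' : Plane) (ℓ : AffineSubspace ℝ Plane) :
    Prop where
  circles_ne : s ≠ s'
  isLine : Module.finrank ℝ ℓ.direction = 1
  meets : MeetsAgainAt s V V' ℓ
  meets' : MeetsAgainAt s' V V' ℓ

/-- The line through `X` parallel to the line `UV` (for `U ≠ V`). -/
noncomputable def parallelThrough (X U V : Plane) : AffineSubspace ℝ Plane :=
  AffineSubspace.mk' X line[ℝ, U, V].direction

/-- The foot of the perpendicular from `S` to the line `UV`. -/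
noncomputable def foot (U V S : Plane) : Plane :=
  (orthogonalProjection line[ℝ, U, V] S : Plane)

/-- The Simson line of `S` with respect to the triangle `ABC`: the span of the feet of the
perpendiculars from `S` to the three sidelines. It is a line when `S` is on the circle `ABC`. -/
noncomputable def simsonLine (A B C S : Plane) : AffineSubspace ℝ Plane :=
  affineSpan ℝ {foot B C S, foot C A S, foot A B S}

/-! The lines from a Miquel point to the three points on the sides make one common directed angle
with the sidelines, with cotangent `carnot / area` (`dot_mul_area_of_miquel`). The midpoints of the
chords of `Γ` are the projections of `O`, so `carnot` takes opposite values on the two inscribed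
triangles. Hence `TA` is the apex of an isosceles triangle on the chord `A₁A₂`: it projects to the
same point of `BC` as `O`, at a signed height proportional to the chord (`brocard_vertex`). The
radical axes `AA'` and `BB'` meet where the heights over the sides are in the ratio of the chords
(`radical_axis`), and normalisation by the area makes these the heights of `TA`, `TB`, `TC`. So
`TA`, `TB`, `TC` are the projections of `O` to the parallels through `R` to the sides.

Let `p`, `q` be the linear projections to the directions of two sides. Then the difference of two of
the `T`s is `(p - q)(O - R)`, and `S` minus the common vertex is a multiple of it. The corresponding
feet of `S` differ by `p - q` of that vector, and `(p - q)²` is a scalar, so they differ by a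
multiple of `O - R` (`feet_sub`). The feet are thus collinear along `OR`, and the converse of
Simson's theorem puts `S` on the circumcircle. -/

namespace Plane

/-- The dot product of two plane vectors in coordinates. -/
def dot (x y : Plane) : ℝ := x 0 * y 0 + x 1 * y 1

/-- The signed area of the parallelogram spanned by two plane vectors. -/
def cross (x y : Plane) : ℝ := x 0 * y 1 - x 1 * y 0

lemma inner_eq_dot (x y : Plane) : inner ℝ x y = dot x y := by
  simp [dot, PiLp.inner_apply, Fin.sum_univ_two, mul_comm]

lemma ext_coord {x y : Plane} (h0 : x 0 = y 0) (h1 : x 1 = y 1) : x = y := by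
  ext i
  fin_cases i
  · exact h0
  · exact h1

lemma dot_self_pos {x y : Plane} (h : x ≠ y) : 0 < dot (y - x) (y - x) := by
  rw [← inner_eq_dot]
  exact real_inner_self_pos.2 (sub_ne_zero.2 h.symm)

lemma mem_sphere_iff_dot {s : EuclideanGeometry.Sphere Plane} {X Y : Plane} (hX : X ∈ s)
    (hY : Y ∈ s) : dot (X - s.center) (X - s.center) = dot (Y - s.center) (Y - s.center) := by
  rw [EuclideanGeometry.mem_sphere, dist_eq_norm] at hX hY
  rw [← inner_eq_dot, ← inner_eq_dot, real_inner_self_eq_norm_sq, real_inner_self_eq_norm_sq,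
    hX, hY]

lemma exists_smul_of_mem_line {U V X : Plane} (h : X ∈ line[ℝ, U, V]) :
    ∃ r : ℝ, X = U + r • (V - U) := by
  obtain ⟨r, rfl⟩ := mem_affineSpan_pair_iff_exists_lineMap_eq.1 h
  exact ⟨r, by simp [AffineMap.lineMap_apply, add_comm]⟩

lemma cross_eq_zero_of_mem_line {U V X : Plane} (h : X ∈ line[ℝ, U, V]) :
    cross (X - U) (V - U) = 0 := by
  obtain ⟨r, rfl⟩ := exists_smul_of_mem_line h
  simp [cross]
  ring

/-! ### Corner circles. -/

/-- The second intersection of a circle and a line through one of its points is the reflection of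
that point in the foot of the perpendicular from the centre, also in the tangent case. -/
lemma dot_add_sub_center {s : EuclideanGeometry.Sphere Plane} {V X : Plane}
    {ℓ : AffineSubspace ℝ Plane} (h : MeetsAgainAt s V X ℓ)
    (hℓ : Module.finrank ℝ ℓ.direction = 1) {d : Plane} (hd : d ∈ ℓ.direction) :
    dot (X + V - (2 : ℝ) • s.center) d = 0 := by
  by_cases hXV : X = V
  · have ht := (h.tangent hXV).inner_left_eq_zero_of_mem
      (AffineSubspace.vadd_mem_of_mem_direction hd h.vertex_mem_line)
    rw [inner_eq_dot] at ht
    subst hXV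
    simp [dot] at ht ⊢
    linarith
  · have hm : X - V ∈ ℓ.direction :=
      AffineSubspace.vsub_mem_direction h.point_mem_line h.vertex_mem_line
    obtain ⟨c, hc⟩ := exists_smul_eq_of_finrank_eq_one hℓ
      (x := (⟨X - V, hm⟩ : ℓ.direction)) (by simpa [Subtype.ext_iff, sub_eq_zero] using hXV)
      ⟨d, hd⟩
    have hc' : c • (X - V) = d := congrArg Subtype.val hc
    have hs := mem_sphere_iff_dot h.point_mem h.vertex_mem
    subst hc'
    simp [dot] at hs ⊢
    linear_combination c * hs

lemma dot_add_sub_center_line {s : EuclideanGeometry.Sphere Plane} {V X U : Plane} (hVU : V ≠ U)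
    (h : MeetsAgainAt s V X line[ℝ, V, U]) :
    dot (X + V - (2 : ℝ) • s.center) (U - V) = 0 := by
  refine dot_add_sub_center h ?_ ?_
  · rw [direction_affineSpan, vectorSpan_pair_rev]
    exact finrank_span_singleton (by simpa [sub_eq_zero] using hVU.symm)
  · rw [direction_affineSpan]
    exact vsub_mem_vectorSpan ℝ (by simp) (by simp)

/-- A point of a corner circle sees the two sidelines under the same directed angle. -/
lemma dot_mul_cross_of_corner {s : EuclideanGeometry.Sphere Plane} {V U W X Y M : Plane}
    (hU : V ≠ U) (hW : V ≠ W) (h : IsCornerCircle s V U W X Y) (hM : M ∈ s) :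
    dot (X - M) (U - V) * cross (Y - M) (W - V) =
      cross (X - M) (U - V) * dot (Y - M) (W - V) := by
  have h1 := dot_add_sub_center_line hU h.1
  have h2 := dot_add_sub_center_line hW h.2
  have h3 := mem_sphere_iff_dot hM h.1.vertex_mem
  have h4 := cross_eq_zero_of_mem_line h.1.point_mem_line
  have h5 := cross_eq_zero_of_mem_line h.2.point_mem_line
  simp only [dot, cross, PiLp.sub_apply, PiLp.add_apply, PiLp.smul_apply, smul_eq_mul] at *
  generalize X 0 = x0 at *
  generalize X 1 = x1 at *
  generalize Y 0 = y0 at *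
  generalize Y 1 = y1 at *
  -- Along `VU`, `X` projects like the antipode `N = 2c - V` of `V`; across it, like `V`; similarly
  -- for `Y`. With `X` and `Y` eliminated, the claim is a multiple of Thales' relation `(N - M) · (V
  -- - M) = 0`.
  have e1 : (x0 - M 0) * (U 0 - V 0) + (x1 - M 1) * (U 1 - V 1) =
    (2 * s.center 0 - V 0 - M 0) * (U 0 - V 0) + (2 * s.center 1 - V 1 - M 1) * (U 1 - V 1) := by
    linear_combination h1
  have e2 : (y0 - M 0) * (W 0 - V 0) + (y1 - M 1) * (W 1 - V 1) =
    (2 * s.center 0 - V 0 - M 0) * (W 0 - V 0) + (2 * s.center 1 - V 1 - M 1) * (W 1 - V 1) := by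
    linear_combination h2
  have e3 : (x0 - M 0) * (U 1 - V 1) - (x1 - M 1) * (U 0 - V 0) =
    (V 0 - M 0) * (U 1 - V 1) - (V 1 - M 1) * (U 0 - V 0) := by
    linear_combination h4
  have e4 : (y0 - M 0) * (W 1 - V 1) - (y1 - M 1) * (W 0 - V 0) =
    (V 0 - M 0) * (W 1 - V 1) - (V 1 - M 1) * (W 0 - V 0) := by
    linear_combination h5
  rw [e1, e2, e3, e4]
  linear_combination ((U 0 - V 0) * (W 1 - V 1) - (U 1 - V 1) * (W 0 - V 0)) * h3

/-! ### The Miquel angle. -/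

/-- Twice the signed area of the triangle `ABC`. -/
def area (A B C : Plane) : ℝ := cross (B - A) (C - A)

/-- For points `D`, `E`, `F` on the sidelines, the quantity that vanishes exactly when the
perpendiculars at `D`, `E`, `F` are concurrent. -/
def carnot (A B C D E F : Plane) : ℝ := dot D (C - B) + dot E (A - C) + dot F (B - A)

lemma area_rotate (A B C : Plane) : area B C A = area A B C := by
  simp [area, cross]; ring

lemma carnot_rotate (A B C D E F : Plane) : carnot B C A E F D = carnot A B C D E F := by
  simp [carnot]; ring

lemma _root_.IsMiquelPoint.rotate {A B C D E F M : Plane}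
    {kA kB kC : EuclideanGeometry.Sphere Plane} (h : IsMiquelPoint A B C D E F kA kB kC M) :
    IsMiquelPoint B C A E F D kB kC kA M :=
  ⟨h.circleB, h.circleC, h.circleA, h.memB, h.memC, h.memA⟩

lemma ne_of_area_ne_zero {A B C : Plane} (h : area A B C ≠ 0) : A ≠ B ∧ B ≠ C ∧ C ≠ A := by
  refine ⟨?_, ?_, ?_⟩ <;> rintro rfl <;> apply h <;> simp [area, cross]
  ring

/-- The common directed angle between the lines from the Miquel point and the sidelines. -/
lemma dot_mul_area_of_miquel {A B C D E F M : Plane} {kA kB kC : EuclideanGeometry.Sphere Plane}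
    (hY : area A B C ≠ 0) (h : IsMiquelPoint A B C D E F kA kB kC M) :
    dot (D - M) (C - B) * area A B C = cross (D - M) (C - B) * carnot A B C D E F := by
  obtain ⟨hAB, hBC, hCA⟩ := ne_of_area_ne_zero hY
  have h1 := dot_mul_cross_of_corner hAB.symm hBC h.circleB h.memB
  have h2 := dot_mul_cross_of_corner hBC.symm hCA h.circleC h.memC
  have e1 := cross_eq_zero_of_mem_line h.circleB.2.point_mem_line
  have e2 := cross_eq_zero_of_mem_line h.circleC.2.point_mem_line
  have e3 := cross_eq_zero_of_mem_line h.circleA.2.point_mem_line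
  -- Both quantities are sums over the sides, with `M` cancelling; proportional pairs of terms give
  -- sums in the same ratio.
  have hs : area A B C = cross (D - M) (C - B) + cross (E - M) (A - C) + cross (F - M) (B - A) := by
    simp only [area, dot, cross, PiLp.sub_apply] at *
    linear_combination -e1 - e2 - e3
  have hc : carnot A B C D E F = dot (D - M) (C - B) + dot (E - M) (A - C) + dot (F - M) (B - A) := by
    simp only [carnot, dot, PiLp.sub_apply]
    ring
  have h1' : dot (F - M) (B - A) * cross (D - M) (C - B) =
      cross (F - M) (B - A) * dot (D - M) (C - B) := by
    simp only [dot, cross, PiLp.sub_apply] at h1 ⊢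
    linear_combination -h1
  have h2' : dot (D - M) (C - B) * cross (E - M) (A - C) =
      cross (D - M) (C - B) * dot (E - M) (A - C) := by
    simp only [dot, cross, PiLp.sub_apply] at h2 ⊢
    linear_combination -h2
  rw [hs, hc]
  linear_combination h2' - h1'

lemma dot_mul_of_mem_line {M D T d : Plane} {σ y : ℝ}
    (h : dot (D - M) d * y = cross (D - M) d * σ) (hT : T ∈ line[ℝ, M, D]) :
    dot (T - D) d * y = cross (T - D) d * σ := by
  obtain ⟨r, rfl⟩ := exists_smul_of_mem_line hT
  simp only [dot, cross, PiLp.sub_apply, PiLp.add_apply, PiLp.smul_apply, smul_eq_mul] at *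
  linear_combination (r - 1) * h

/-! ### Chords of `Γ` and the generalized Brocard triangle. -/

/-- What is used of a circle cutting a sideline. -/
lemma _root_.CutsLineAt.dot_eq {Γ : EuclideanGeometry.Sphere Plane} {U V X Y : Plane}
    (h : CutsLineAt Γ U V X Y) :
    dot X (V - U) + dot Y (V - U) = 2 * dot Γ.center (V - U) ∧
      cross (X - U) (V - U) = 0 ∧ cross (Y - U) (V - U) = 0 ∧
      (U ≠ V → dot (X - Y) (V - U) ≠ 0) := by
  obtain ⟨hne, h⟩ := h
  have hX : X ∈ (Γ : Set Plane) ∩ line[ℝ, U, V] := by rw [h]; simp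
  have hY : Y ∈ (Γ : Set Plane) ∩ line[ℝ, U, V] := by rw [h]; simp
  have hs := mem_sphere_iff_dot (s := Γ) hX.1 hY.1
  refine ⟨?_, cross_eq_zero_of_mem_line hX.2, cross_eq_zero_of_mem_line hY.2, ?_⟩
  all_goals
    obtain ⟨x, rfl⟩ := exists_smul_of_mem_line hX.2
    obtain ⟨y, rfl⟩ := exists_smul_of_mem_line hY.2
    have hxy : x - y ≠ 0 := fun h0 => hne (by rw [sub_eq_zero.1 h0])
  · apply mul_left_cancel₀ hxy
    simp only [dot, PiLp.sub_apply, PiLp.add_apply, PiLp.smul_apply, smul_eq_mul] at *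
    linear_combination hs
  · intro hUV
    have := mul_ne_zero hxy (dot_self_pos hUV).ne'
    convert this using 1
    simp only [dot, PiLp.sub_apply, PiLp.add_apply, PiLp.smul_apply, smul_eq_mul]
    ring

/-- Each chord midpoint projects to its side like the centre, and the side vectors sum to zero. -/
lemma carnot_add_eq_zero {A B C D E F D' E' F' : Plane} {Γ : EuclideanGeometry.Sphere Plane}
    (hA : CutsLineAt Γ B C D D') (hB : CutsLineAt Γ C A E E') (hC : CutsLineAt Γ A B F F') :
    carnot A B C D' E' F' = -carnot A B C D E F := by
  have h1 := hA.dot_eq.1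
  have h2 := hB.dot_eq.1
  have h3 := hC.dot_eq.1
  simp only [carnot, dot, PiLp.sub_apply] at *
  linear_combination h1 + h2 + h3

/-- The vertex `T` of the generalized Brocard triangle lies on the perpendicular from the centre to
the side, at a height proportional to the chord cut off on that side. -/
lemma brocard_vertex {A B C D E F D' E' F' P Q T : Plane}
    {Γ kA kB kC kA' kB' kC' : EuclideanGeometry.Sphere Plane} (hY : area A B C ≠ 0)
    (hA : CutsLineAt Γ B C D D') (hB : CutsLineAt Γ C A E E') (hC : CutsLineAt Γ A B F F')
    (hP : IsMiquelPoint A B C D E F kA kB kC P)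
    (hQ : IsMiquelPoint A B C D' E' F' kA' kB' kC' Q)
    (hT : IsLineIntersection P D Q D' T) :
    dot (T - Γ.center) (C - B) = 0 ∧
      2 * carnot A B C D E F * cross (T - B) (C - B) = -(dot (D - D') (C - B) * area A B C) := by
  obtain ⟨-, -, hT⟩ := hT
  have hTm : T ∈ (line[ℝ, P, D] : Set Plane) ∩ line[ℝ, Q, D'] := by rw [hT]; simp
  have hBC := (ne_of_area_ne_zero hY).2.1
  have h1 := dot_mul_of_mem_line (dot_mul_area_of_miquel hY hP) hTm.1
  have h2 := dot_mul_of_mem_line (dot_mul_area_of_miquel hY hQ) hTm.2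
  -- The sign change makes the angles at `D` and `D'` opposite: the sum of the two relations locates
  -- the projection of `T`, their difference its height.
  rw [carnot_add_eq_zero hA hB hC] at h2
  generalize carnot A B C D E F = σ at *
  obtain ⟨e1, e2, e3, -⟩ := hA.dot_eq
  constructor
  · apply mul_left_cancel₀ hY
    generalize area A B C = y at *
    simp only [dot, cross, PiLp.sub_apply] at *
    linear_combination (1 / 2) * h1 + (1 / 2) * h2 + y / 2 * e1 - σ / 2 * e2 + σ / 2 * e3
  · generalize area A B C = y at *
    simp only [dot, cross, PiLp.sub_apply] at *
    linear_combination h2 - h1 + σ * e2 + σ * e3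

/-! ### Radical axes. -/

/-- The components of the difference of the centres along `CA` and `AB` are half the differences `E
- E'` and `F - F'`, and the common chord is orthogonal to it. The claim follows from the linear
relation between `R - A`, `B - A` and `C - A`. -/
lemma radical_axis {A B C E F E' F' A' R : Plane} {kA kA' : EuclideanGeometry.Sphere Plane}
    {ℓ : AffineSubspace ℝ Plane} (hY : area A B C ≠ 0)
    (h : IsCornerCircle kA A C B E F) (h' : IsCornerCircle kA' A C B E' F')
    (hℓ : IsCommonChord kA kA' A A' ℓ) (hR : R ∈ ℓ) :
    dot (E - E') (A - C) * cross (R - A) (B - A) =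
      dot (F - F') (B - A) * cross (R - C) (A - C) := by
  obtain ⟨hAB, hBC, hCA⟩ := ne_of_area_ne_zero hY
  have hd : R - A ∈ ℓ.direction :=
    AffineSubspace.vsub_mem_direction hR hℓ.meets.vertex_mem_line
  have h1 := dot_add_sub_center hℓ.meets hℓ.isLine hd
  have h2 := dot_add_sub_center hℓ.meets' hℓ.isLine hd
  have h3 := dot_add_sub_center_line hCA.symm h.1
  have h4 := dot_add_sub_center_line hCA.symm h'.1
  have h5 := dot_add_sub_center_line hAB h.2
  have h6 := dot_add_sub_center_line hAB h'.2
  simp only [dot, cross, PiLp.sub_apply, PiLp.add_apply, PiLp.smul_apply, smul_eq_mul] at *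
  linear_combination ((R 0 - A 0) * (B 1 - A 1) - (R 1 - A 1) * (B 0 - A 0)) * (h4 - h3) +
    ((R 0 - A 0) * (C 1 - A 1) - (R 1 - A 1) * (C 0 - A 0)) * (h5 - h6) +
    ((B 0 - A 0) * (C 1 - A 1) - (B 1 - A 1) * (C 0 - A 0)) * (h2 - h1)

/-- The barycentric coordinates of the intersection of two radical axes. -/
lemma radical_center {u v w x y z : ℝ} (hw : w ≠ 0) (h1 : v * z = w * y) (h2 : w * x = u * z) :
    (u + v + w) * x = u * (x + y + z) ∧ (u + v + w) * y = v * (x + y + z) ∧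
      (u + v + w) * z = w * (x + y + z) := by
  have h3 : v * x = u * y := mul_left_cancel₀ hw (by linear_combination v * h2 + u * h1)
  refine ⟨?_, ?_, ?_⟩
  · linear_combination h3 + h2
  · linear_combination -h1 - h3
  · linear_combination h1 - h2

/-! ### Projections to lines. -/

lemma eq_add_smul_of_foot {U d S F : Plane} (hd : dot d d ≠ 0) (h1 : cross (F - U) d = 0)
    (h2 : dot (S - F) d = 0) : F = U + (dot (S - U) d / dot d d) • d := by
  have h0 : dot d d * F 0 = dot d d * U 0 + dot (S - U) d * d 0 := by
    simp only [dot, cross, PiLp.sub_apply] at *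
    linear_combination d 1 * h1 - d 0 * h2
  have h1 : dot d d * F 1 = dot d d * U 1 + dot (S - U) d * d 1 := by
    simp only [dot, cross, PiLp.sub_apply] at *
    linear_combination -d 0 * h1 - d 1 * h2
  apply ext_coord <;> apply mul_left_cancel₀ hd <;>
    simp only [PiLp.add_apply, PiLp.smul_apply, smul_eq_mul]
  · rw [h0]; field_simp
  · rw [h1]; field_simp

/-- The difference of two line projections squares to a scalar. -/
lemma feet_sub {V b c O R X Y S F G : Plane} (hb : dot b b ≠ 0) (hc : dot c c ≠ 0)
    (hX : dot (X - O) b = 0) (hX' : cross (X - R) b = 0)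
    (hY : dot (Y - O) c = 0) (hY' : cross (Y - R) c = 0)
    (hF : dot (S - F) b = 0) (hF' : cross (F - V) b = 0)
    (hG : dot (S - G) c = 0) (hG' : cross (G - V) c = 0)
    {k : ℝ} (hS : S - V = k • (X - Y)) :
    F - G = (k * (cross b c ^ 2 / (dot b b * dot c c))) • (O - R) := by
  have eX := eq_add_smul_of_foot (S := O) hb hX' (by simp only [dot, PiLp.sub_apply] at *; linarith)
  have eY := eq_add_smul_of_foot (S := O) hc hY' (by simp only [dot, PiLp.sub_apply] at *; linarith)
  rw [eq_add_smul_of_foot hb hF' hF, eq_add_smul_of_foot hc hG' hG, hS, eX, eY]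
  clear eX eY hX hX' hY hY' hF hF' hG hG' hS
  apply ext_coord <;>
    simp only [PiLp.add_apply, PiLp.sub_apply, PiLp.smul_apply, smul_eq_mul, dot, cross] at * <;>
    rw [← pow_two, ← pow_two] at hb hc <;>
    generalize b 0 = b0, b 1 = b1, c 0 = c0, c 1 = c1 at * <;>
    field_simp <;> ring

lemma foot_spec (U V S : Plane) :
    cross (foot U V S - U) (V - U) = 0 ∧ dot (S - foot U V S) (V - U) = 0 := by
  refine ⟨cross_eq_zero_of_mem_line (EuclideanGeometry.orthogonalProjection_mem S), ?_⟩
  rw [← inner_eq_dot]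
  have h := EuclideanGeometry.vsub_orthogonalProjection_mem_direction_orthogonal line[ℝ, U, V] S
  refine (Submodule.mem_orthogonal' _ _).1 h (V - U) ?_
  rw [direction_affineSpan]
  exact vsub_mem_vectorSpan ℝ (by simp) (by simp)

/-! ### Circumcircle and converse of Simson's theorem. -/

/-- The vector from `0` to the circumcentre of the triangle `0`, `p`, `q`. -/
noncomputable def circumVec (p q : Plane) : Plane :=
  !₂[(dot p p * q 1 - dot q q * p 1) / (2 * cross p q),
    (dot q q * p 0 - dot p p * q 0) / (2 * cross p q)]

lemma two_mul_dot_circumVec {p q : Plane} (h : cross p q ≠ 0) (s : Plane) :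
    2 * dot s (circumVec p q) * cross p q = dot p p * cross s q + dot q q * cross p s := by
  simp only [circumVec, dot, cross, PiLp.toLp_apply, Matrix.cons_val_zero, Matrix.cons_val_one] at *
  field_simp
  ring

lemma mem_circle_of_dot {C s k : Plane} {r : ℝ} (hr : dot k k = r ^ 2) (hr0 : 0 ≤ r)
    (h : 2 * dot (s - C) k = dot (s - C) (s - C)) : dist s (C + k) = r := by
  rw [dist_eq_norm, ← Real.sqrt_sq (norm_nonneg (s - (C + k))), ← Real.sqrt_sq hr0]
  congr 1
  rw [← real_inner_self_eq_norm_sq, inner_eq_dot]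
  simp only [dot, PiLp.sub_apply, PiLp.add_apply] at *
  linear_combination hr - h

lemma cospherical_of_concyclic {A B C S : Plane} (hY : cross (A - C) (B - C) ≠ 0)
    (h : dot (S - C) (S - C) * cross (A - C) (B - C) =
      dot (A - C) (A - C) * cross (S - C) (B - C) + dot (B - C) (B - C) * cross (A - C) (S - C)) :
    EuclideanGeometry.Cospherical {A, B, C, S} := by
  set k := circumVec (A - C) (B - C) with hk
  have hr : dot k k = √(dot k k) ^ 2 := (Real.sq_sqrt (by
    simp only [dot]; exact add_nonneg (mul_self_nonneg _) (mul_self_nonneg _))).symm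
  refine ⟨C + k, √(dot k k), ?_⟩
  have hs (X : Plane) (hX : dot (X - C) (X - C) * cross (A - C) (B - C) =
      dot (A - C) (A - C) * cross (X - C) (B - C) +
        dot (B - C) (B - C) * cross (A - C) (X - C)) : dist X (C + k) = √(dot k k) := by
    refine mem_circle_of_dot hr (Real.sqrt_nonneg _) (mul_right_cancel₀ hY ?_)
    rw [two_mul_dot_circumVec hY, hX]
  rintro p (rfl | rfl | rfl | rfl)
  · refine hs _ ?_
    simp only [dot, cross]
    ring
  · refine hs _ ?_
    simp only [dot, cross]
    ring
  · refine hs _ ?_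
    simp only [dot, cross, PiLp.sub_apply]
    ring
  · exact hs _ h

/-- The area of the pedal triangle in coordinates. -/
lemma pedal_area_identity (p0 p1 q0 q1 s0 s1 : ℝ) (ha : q0 ^ 2 + q1 ^ 2 ≠ 0)
    (hb : p0 ^ 2 + p1 ^ 2 ≠ 0) (hc : (p0 - q0) ^ 2 + (p1 - q1) ^ 2 ≠ 0) {x y z : ℝ}
    (hx : x * (q0 ^ 2 + q1 ^ 2) = s0 * q0 + s1 * q1)
    (hy : y * (p0 ^ 2 + p1 ^ 2) = s0 * p0 + s1 * p1)
    (hz : z * ((p0 - q0) ^ 2 + (p1 - q1) ^ 2) = (s0 - p0) * (q0 - p0) + (s1 - p1) * (q1 - p1))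
    (h : (y * p0 - x * q0) * (p1 + z * (q1 - p1) - x * q1) -
      (y * p1 - x * q1) * (p0 + z * (q0 - p0) - x * q0) = 0) :
    (p0 * q1 - p1 * q0) ^ 2 * ((s0 ^ 2 + s1 ^ 2) * (p0 * q1 - p1 * q0) -
      (p0 ^ 2 + p1 ^ 2) * (s0 * q1 - s1 * q0) - (q0 ^ 2 + q1 ^ 2) * (p0 * s1 - p1 * s0)) = 0 := by
  rw [← eq_div_iff ha] at hx
  rw [← eq_div_iff hb] at hy
  rw [← eq_div_iff hc] at hz
  subst hx hy hz
  field_simp at h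
  apply mul_left_cancel₀ ha
  linear_combination -h

/-- If the feet of the perpendiculars are collinear, the point is on the circumcircle. -/
lemma cospherical_of_feet_collinear {A B C S F G H : Plane} (hY : area A B C ≠ 0)
    (hF : dot (S - F) (C - B) = 0) (hF' : cross (F - B) (C - B) = 0)
    (hG : dot (S - G) (A - C) = 0) (hG' : cross (G - C) (A - C) = 0)
    (hH : dot (S - H) (B - A) = 0) (hH' : cross (H - A) (B - A) = 0)
    (h : cross (G - F) (H - F) = 0) :
    EuclideanGeometry.Cospherical {A, B, C, S} := by
  obtain ⟨hAB, hBC, hCA⟩ := ne_of_area_ne_zero hY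
  have ha := (dot_self_pos hBC).ne'
  have hb := (dot_self_pos hCA).ne'
  have hc := (dot_self_pos hAB).ne'
  rw [eq_add_smul_of_foot ha hF' hF, eq_add_smul_of_foot hb hG' hG,
    eq_add_smul_of_foot hc hH' hH] at h
  clear hF hF' hG hG' hH hH'
  have hY' : cross (A - C) (B - C) ≠ 0 := by
    convert hY using 1
    simp [area, cross]; ring
  refine cospherical_of_concyclic hY' ?_
  -- The origin is moved to `C`. On `BC` the foot is measured from `B`, hence the `1 -` in `x`.
  have := pedal_area_identity (A 0 - C 0) (A 1 - C 1) (B 0 - C 0) (B 1 - C 1) (S 0 - C 0)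
    (S 1 - C 1) (x := 1 - dot (S - B) (C - B) / dot (C - B) (C - B))
    (y := dot (S - C) (A - C) / dot (A - C) (A - C))
    (z := dot (S - A) (B - A) / dot (B - A) (B - A))
    (by simp only [dot, PiLp.sub_apply] at ha; convert ha using 1; ring)
    (by simp only [dot, PiLp.sub_apply] at hb; convert hb using 1; ring)
    (by simp only [dot, PiLp.sub_apply] at hc; convert hc using 1; ring)
    (by
      have := div_mul_cancel₀ (dot (S - B) (C - B)) ha
      generalize dot (S - B) (C - B) / dot (C - B) (C - B) = t at *
      simp only [dot, PiLp.sub_apply] at this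
      linear_combination -this)
    (by
      have := div_mul_cancel₀ (dot (S - C) (A - C)) hb
      generalize dot (S - C) (A - C) / dot (A - C) (A - C) = t at *
      simp only [dot, PiLp.sub_apply] at this
      linear_combination this)
    (by
      have := div_mul_cancel₀ (dot (S - A) (B - A)) hc
      generalize dot (S - A) (B - A) / dot (B - A) (B - A) = t at *
      simp only [dot, PiLp.sub_apply] at this
      linear_combination this)
    (by
      generalize dot (S - B) (C - B) / dot (C - B) (C - B) = t at *
      generalize dot (S - C) (A - C) / dot (A - C) (A - C) = t' at *
      generalize dot (S - A) (B - A) / dot (B - A) (B - A) = t'' at *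
      simp only [cross, PiLp.sub_apply, PiLp.add_apply, PiLp.smul_apply, smul_eq_mul] at h
      linear_combination h)
  simp only [dot, cross, PiLp.sub_apply] at *
  have := (mul_eq_zero.1 this).resolve_left (pow_ne_zero 2 hY')
  linear_combination this

lemma exists_smul_of_mem_parallelThrough {X U V S : Plane} (h : S ∈ parallelThrough X U V) :
    ∃ r : ℝ, S - X = r • (U - V) := by
  rw [parallelThrough, AffineSubspace.mem_mk', direction_affineSpan, mem_vectorSpan_pair] at h
  obtain ⟨r, hr⟩ := h
  exact ⟨r, hr.symm⟩

lemma span_feet_parallel {F G H O R : Plane} {κ μ : ℝ} (h : κ ≠ 0 ∨ μ ≠ 0)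
    (h1 : G - H = κ • (O - R)) (h2 : H - F = μ • (O - R)) :
    affineSpan ℝ {F, G, H} ∥ line[ℝ, O, R] := by
  rw [AffineSubspace.affineSpan_parallel_iff_vectorSpan_eq_and_eq_empty_iff_eq_empty]
  refine ⟨?_, iff_of_false (Set.insert_nonempty _ _).ne_empty
    (Set.insert_nonempty _ _).ne_empty⟩
  rw [vectorSpan_eq_span_vsub_set_right ℝ (p := H) (by simp), vectorSpan_pair]
  apply le_antisymm
  · rw [Submodule.span_le]
    rintro _ ⟨X, (rfl | rfl | rfl), rfl⟩
    · refine Submodule.mem_span_singleton.2 ⟨-μ, ?_⟩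
      simp [← h2]
    · exact Submodule.mem_span_singleton.2 ⟨κ, h1.symm⟩
    · simp
  · rw [Submodule.span_singleton_le_iff_mem]
    rcases h with h | h
    · have : O - R = κ⁻¹ • (G - H) := by rw [h1, inv_smul_smul₀ h]
      rw [vsub_eq_sub, this]
      exact Submodule.smul_mem _ _ (Submodule.subset_span ⟨G, by simp, rfl⟩)
    · have : O - R = (-μ⁻¹) • (F - H) := by
        rw [← neg_sub H F, h2, neg_smul_neg, inv_smul_smul₀ h]
      rw [vsub_eq_sub, this]
      exact Submodule.smul_mem _ _ (Submodule.subset_span ⟨F, by simp, rfl⟩)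

lemma area_ne_zero {A B C : Plane} (h : AffineIndependent ℝ ![A, B, C]) : area A B C ≠ 0 := by
  intro h0
  rw [affineIndependent_iff_not_collinear_set] at h
  have hAB : A ≠ B := by
    rintro rfl
    exact h (by simpa using collinear_pair ℝ A C)
  have hd := (dot_self_pos hAB).ne'
  refine h ((collinear_iff_of_mem (p₀ := A) (by simp)).2 ⟨B - A, ?_⟩)
  rintro p (rfl | rfl | rfl)
  · exact ⟨0, by simp⟩
  · exact ⟨1, by simp⟩
  · refine ⟨dot (p - A) (B - A) / dot (B - A) (B - A), ?_⟩
    rw [vadd_eq_add, add_comm]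
    exact eq_add_smul_of_foot hd (by simp only [area, cross] at *; linarith) (by simp [dot])

end Plane

/-! ### The main theorem. -/

open Plane in
theorem proposition4p4
    -- the triangle
    (A B C : Plane) (hABC : AffineIndependent ℝ ![A, B, C])
    -- the circle, with centre `O = Γ.center`, and its intersections with the sidelines
    (Γ : Sphere Plane) (A₁ A₂ B₁ B₂ C₁ C₂ : Plane)
    (hA : CutsLineAt Γ B C A₁ A₂) (hB : CutsLineAt Γ C A B₁ B₂) (hC : CutsLineAt Γ A B C₁ C₂)
    -- the Miquel points of the two inscribed triangles
    (kA₁ kB₁ kC₁ kA₂ kB₂ kC₂ : Sphere Plane) (P Q : Plane)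
    (hP : IsMiquelPoint A B C A₁ B₁ C₁ kA₁ kB₁ kC₁ P)
    (hQ : IsMiquelPoint A B C A₂ B₂ C₂ kA₂ kB₂ kC₂ Q)
    -- the generalized first Brocard triangle
    (TA TB TC : Plane)
    (hTA : IsLineIntersection P A₁ Q A₂ TA)
    (hTB : IsLineIntersection P B₁ Q B₂ TB)
    (hTC : IsLineIntersection P C₁ Q C₂ TC)
    -- the point `R` where the lines `AA'` and `BB'` (and then also `CC'`) meet
    (A' B' : Plane) (lA lB : AffineSubspace ℝ Plane)
    (hA' : IsCommonChord kA₁ kA₂ A A' lA) (hB' : IsCommonChord kB₁ kB₂ B B' lB)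
    (R : Plane) (hRA : R ∈ lA) (hRB : R ∈ lB)
    -- the generalized Steiner point: the parallels from `A` to `TB TC` and from `B` to `TC TA` meet
    (hTBC : TB ≠ TC) (hTCA : TC ≠ TA)
    (S : Plane) (hSA : S ∈ parallelThrough A TB TC) (hSB : S ∈ parallelThrough B TC TA) :
    -- `S` is on the circle `ABC`, the line `OR` is determined, and the claim holds
    Cospherical {A, B, C, S} ∧ Γ.center ≠ R ∧
      (simsonLine A B C S) ∥ line[ℝ, Γ.center, R] := by
  have hY := area_ne_zero hABC
  obtain ⟨hAB, hBC, hCA⟩ := ne_of_area_ne_zero hY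
  have hYB : area B C A ≠ 0 := by rwa [area_rotate]
  have hYC : area C A B ≠ 0 := by rwa [area_rotate, area_rotate] 
  obtain ⟨a1, a2⟩ := brocard_vertex hY hA hB hC hP hQ hTA
  obtain ⟨b1, b2⟩ := brocard_vertex hYB hB hC hA hP.rotate hQ.rotate hTB
  obtain ⟨c1, c2⟩ := brocard_vertex hYC hC hA hB hP.rotate.rotate hQ.rotate.rotate hTC
  have ra := radical_axis hY hP.circleA hQ.circleA hA' hRA
  have rb := radical_axis hYB hP.circleB hQ.circleB hB' hRB
  obtain ⟨ea1, ea2, ea3, ea4⟩ := hA.dot_eq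
  obtain ⟨eb1, eb2, eb3, eb4⟩ := hB.dot_eq
  obtain ⟨ec1, ec2, ec3, ec4⟩ := hC.dot_eq
  obtain ⟨x, y, z⟩ := radical_center (ec4 hAB) ra rb
  have hs : dot (A₁ - A₂) (C - B) + dot (B₁ - B₂) (A - C) + dot (C₁ - C₂) (B - A) =
      2 * carnot A B C A₁ B₁ C₁ := by
    simp only [carnot, dot, PiLp.sub_apply] at *
    linear_combination -ea1 - eb1 - ec1
  have hr : cross (R - B) (C - B) + cross (R - C) (A - C) + cross (R - A) (B - A) =
      -area A B C := by
    simp only [area, cross, PiLp.sub_apply]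
    ring
  rw [hs, hr] at x y z
  rw [carnot_rotate, area_rotate] at b2
  rw [carnot_rotate, carnot_rotate, area_rotate, area_rotate] at c2
  -- Otherwise `a2` would make the chord on `BC` degenerate.
  have hσ : 2 * carnot A B C A₁ B₁ C₁ ≠ 0 := by
    intro h0
    rw [h0, zero_mul] at a2
    exact mul_ne_zero (ea4 hBC) hY (by linarith)
  -- `TA` and `R` have the same signed height over `BC`.
  have a3 : cross (TA - R) (C - B) = 0 := by
    apply mul_left_cancel₀ hσ
    simp only [cross, PiLp.sub_apply] at *
    linear_combination a2 - x
  have b3 : cross (TB - R) (A - C) = 0 := by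
    apply mul_left_cancel₀ hσ
    simp only [cross, PiLp.sub_apply] at *
    linear_combination b2 - y
  have c3 : cross (TC - R) (B - A) = 0 := by
    apply mul_left_cancel₀ hσ
    simp only [cross, PiLp.sub_apply] at *
    linear_combination c2 - z
  have na := (dot_self_pos hBC).ne'
  have nb := (dot_self_pos hCA).ne'
  have nc := (dot_self_pos hAB).ne'
  -- If `O = R`, then `TB` and `TC` are both projections of `O` to lines through `O`, so they
  -- coincide.
  have hOR : Γ.center ≠ R := by
    rintro rfl
    apply hTBC
    have h1 := eq_add_smul_of_foot (S := Γ.center) nb b3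
      (by simp only [dot, PiLp.sub_apply] at *; linarith)
    have h2 := eq_add_smul_of_foot (S := Γ.center) nc c3
      (by simp only [dot, PiLp.sub_apply] at *; linarith)
    rw [h1, h2]
    simp [dot]
  obtain ⟨k, hk⟩ := exists_smul_of_mem_parallelThrough hSA
  obtain ⟨l, hl⟩ := exists_smul_of_mem_parallelThrough hSB
  obtain ⟨fa, fa'⟩ := foot_spec B C S
  obtain ⟨fb, fb'⟩ := foot_spec C A S
  obtain ⟨fc, fc'⟩ := foot_spec A B S
  have d1 := feet_sub nb nc b1 b3 c1 c3 fb' (V := A)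
    (by simp only [cross, PiLp.sub_apply] at *; linear_combination fb) fc' fc hk
  have d2 := feet_sub nc na c1 c3 a1 a3 fc' (V := B)
    (by simp only [cross, PiLp.sub_apply] at *; linear_combination fc) fa' fa hl
  set κ := k * (cross (A - C) (B - A) ^ 2 / (dot (A - C) (A - C) * dot (B - A) (B - A))) with hκ
  set μ := l * (cross (B - A) (C - B) ^ 2 / (dot (B - A) (B - A) * dot (C - B) (C - B))) with hμ
  -- If both vanished, `S` would equal both `A` and `B`.
  have hκμ : κ ≠ 0 ∨ μ ≠ 0 := by
    by_contra! h
    have hc1 : cross (A - C) (B - A) ≠ 0 := by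
      convert hY using 1
      simp only [area, cross, PiLp.sub_apply]; ring
    have hc2 : cross (B - A) (C - B) ≠ 0 := by
      convert hY using 1
      simp only [area, cross, PiLp.sub_apply]; ring
    have hk0 : k = 0 := by simpa [hκ, hc1, na, nb, nc] using h.1
    have hl0 : l = 0 := by simpa [hμ, hc2, na, nb, nc] using h.2
    rw [hk0, zero_smul, sub_eq_zero] at hk
    rw [hl0, zero_smul, sub_eq_zero] at hl
    exact hAB (hk.symm.trans hl)
  refine ⟨cospherical_of_feet_collinear hY fa' fa fb' fb fc' fc ?_, hOR, ?_⟩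
  · rw [← sub_add_sub_cancel _ (foot A B S), d1, d2]
    simp only [cross, PiLp.sub_apply, PiLp.add_apply, PiLp.smul_apply, smul_eq_mul]
    ring
  · exact span_feet_parallel hκμ d1 d2
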